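/- Let $\Omega=\{0,1\}^{\infty}$ and, for $\omega\in\Omega$ and $t\ge 0$, let $\omega^{t}\subseteq\Omega$ be the cylinder of all paths that agree with $\omega$ in the first $t$ coordinates. Let $\Sigma$ be any $\sigma$-algebra on $\Omega$ containing all cylinders, let $\mathbb{P}$ be the set of finitely additive probabilities on $(\Omega,\Sigma)$, and let $\mathcal{F}\subseteq\Sigma$ be the algebra generated by the cylinders. For $P\in\mathbb{P}$ write $P_{\mathcal F}$ for the restriction of $P$ to $\mathcal F$, let $E(P_{\mathcal F},\mathcal F,\Sigma)$ be the convex set of all $Q\in\mathbb{P}$ with $Q(A)=P(A)$ for every $A\in\mathcal F$, and write $P(E\mid\omega^t)=P(E\cap\omega^t)/P(\omega^t)$ when $P(\omega^t)>0$, with the convention $P(E\mid\omega^t)=0$ when $P(\omega^t)=0$ (this convention does not affect the theorem). For $P,Q\in\mathbb{P}$: - $Q\ll P$ means that for every sequence $(E_n)$ in $\Sigma$, if $P(E_n)\to 0$ then $Q(E_n)\to 0$; - $P$ merges with $Q$ if for every $\varepsilon>0$ $$\lim_{t\to\infty}Q\Bigl(\Bigl\{\omega:\ \sup_{E\in\Sigma}\bigl|P(E\mid\omega^{t})-Q(E\mid\omega^{t})\bigr|>\varepsilon\Bigr\}\Bigr)=0;$$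 - $P$ satisfies the Blackwell--Dubins property if $P$ merges with every $Q\in\mathbb{P}$ such that $Q\ll P$. Then for every $P\in\mathbb{P}$ the following are equivalent: 1. $P$ is an extreme point of $E(P_{\mathcal F},\mathcal F,\Sigma)$. 2. $P$ satisfies the Blackwell--Dubins property. 3. For all $Q,R\in\mathbb{P}$, if $P=\alpha Q+(1-\alpha)R$ for some $\alpha\in(0,1)$, then $P$ merges with $Q$ and with $R$. -/

import Mathlib

noncomputable section

namespace Merging

open MeasureTheory Filter Topology

/-- The set of paths `{0,1}^∞`. -/
abbrev Path : Type := ℕ → Bool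

/-- The cylinder `ω^t` of all paths that agree with `ω` in the first `t` periods. -/
abbrev cyl (ω : Path) (t : ℕ) : Set Path := PiNat.cylinder (E := fun _ : ℕ => Bool) ω t

/-- The σ-algebra `S` contains all cylinders. -/
def ContainsCylinders (S : MeasurableSpace Path) : Prop :=
  ∀ (ω : Path) (t : ℕ), MeasurableSet[S] (cyl ω t)

/-- The algebra of subsets of `{0,1}^∞` generated by the cylinders. -/
def cylAlgebra : Set (Set Path) :=
  generateSetAlgebra {C | ∃ (ω : Path) (t : ℕ), C = cyl ω t}

/-- The events of the σ-algebra `S`, as a family of sets. -/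
def events (S : MeasurableSpace Path) : Set (Set Path) := {A | MeasurableSet[S] A}

/-- The finitely additive probabilities on the algebra of sets `𝒜`, as a subset of the real vector
space of functions `𝒜 → ℝ`. -/
def finAddProb (𝒜 : Set (Set Path)) : Set (𝒜 → ℝ) :=
  {P | (∀ A, 0 ≤ P A) ∧
    (∀ A : 𝒜, (A : Set Path) = Set.univ → P A = 1) ∧
    ∀ A B C : 𝒜, Disjoint (A : Set Path) B → (C : Set Path) = (A : Set Path) ∪ B → P C = P A + P B}

/-- The restriction of a set function from `𝒜₂` to a smaller family `𝒜₁`. -/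
def restrict {𝒜₁ 𝒜₂ : Set (Set Path)} (h : 𝒜₁ ⊆ 𝒜₂) (P : 𝒜₂ → ℝ) : 𝒜₁ → ℝ :=
  fun A => P ⟨A, h A.2⟩

/-- The set of finitely additive probabilities on `𝒜₂` that extend `P` from `𝒜₁` to `𝒜₂`. -/
def extensions {𝒜₁ 𝒜₂ : Set (Set Path)} (h : 𝒜₁ ⊆ 𝒜₂) (P : 𝒜₁ → ℝ) : Set (𝒜₂ → ℝ) :=
  {Q | Q ∈ finAddProb 𝒜₂ ∧ restrict h Q = P}

theorem cylAlgebra_subset_events {S : MeasurableSpace Path} (hS : ContainsCylinders S) :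
    cylAlgebra ⊆ events S := by
  intro A hA
  induction hA with
  | base s hs => obtain ⟨ω, t, rfl⟩ := hs; exact hS ω t
  | empty => exact @MeasurableSet.empty _ S
  | compl s _ ih => exact MeasurableSet.compl ih
  | union s t _ _ ihs iht => exact MeasurableSet.union ihs iht

/-- The conditional probability `P(E | ω^t) = P(E ∩ ω^t) / P(ω^t)`. (It is meant for
`P(ω^t) > 0`; otherwise the division returns `0`.) -/
def condProb {S : MeasurableSpace Path} (hS : ContainsCylinders S) (P : events S → ℝ)
    (ω : Path) (t : ℕ) (E : events S) : ℝ :=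
  P ⟨E ∩ cyl ω t, MeasurableSet.inter E.2 (hS ω t)⟩ / P ⟨cyl ω t, hS ω t⟩

/-- The distance `sup_E |P(E | ω^t) - Q(E | ω^t)|` between the forecasts of `P` and `Q`, where
`E` ranges over all events. -/
def forecastDist {S : MeasurableSpace Path} (hS : ContainsCylinders S) (P Q : events S → ℝ)
    (ω : Path) (t : ℕ) : ℝ :=
  ⨆ E : events S, |condProb hS P ω t E - condProb hS Q ω t E|

/-- The set of paths along which the forecasts at time `t` differ by more than `ε` is an event. -/
theorem forecastDist_event {S : MeasurableSpace Path} (hS : ContainsCylinders S)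
    (P Q : events S → ℝ) (t : ℕ) (ε : ℝ) :
    {ω | forecastDist hS P Q ω t > ε} ∈ events S := by
  have hdep : ∀ ω ω' : Path, cyl ω t = cyl ω' t →
      forecastDist hS P Q ω t = forecastDist hS P Q ω' t := by
    intro ω ω' h
    simp only [forecastDist, condProb, h]
  have hfin : (Set.range fun ω : Path => cyl ω t).Finite := by
    refine Set.Finite.subset (Set.finite_range
      (fun x : Fin t → Bool => {y : Path | ∀ i : Fin t, y i = x i})) ?_
    rintro _ ⟨ω, rfl⟩
    refine ⟨fun i => ω i, ?_⟩
    ext y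
    exact ⟨fun h i hi => h ⟨i, hi⟩, fun h i => h i i.2⟩
  have heq : {ω | forecastDist hS P Q ω t > ε} =
      ⋃₀ ((fun ω : Path => cyl ω t) '' {ω | forecastDist hS P Q ω t > ε}) := by
    ext y
    constructor
    · intro hy
      exact ⟨cyl y t, ⟨y, hy, rfl⟩, PiNat.self_mem_cylinder y t⟩
    · rintro ⟨_, ⟨ω, hω, rfl⟩, hy⟩
      have h : cyl y t = cyl ω t := PiNat.mem_cylinder_iff_eq.1 hy
      exact lt_of_lt_of_eq hω (hdep y ω h).symm
  rw [heq]
  refine MeasurableSet.sUnion (hfin.subset (Set.image_subset_range _ _)).countable ?_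
  rintro _ ⟨ω, _, rfl⟩
  exact hS ω t

/-- `P` merges with `Q`: under `Q`, the distance between the forecasts of `P` and `Q` goes to `0`
in probability. -/
def Merges {S : MeasurableSpace Path} (hS : ContainsCylinders S) (P Q : events S → ℝ) : Prop :=
  ∀ ε : ℝ, 0 < ε →
    Tendsto (fun t : ℕ => Q ⟨{ω | forecastDist hS P Q ω t > ε}, forecastDist_event hS P Q t ε⟩)
      atTop (𝓝 0)

/-- `Q ≪ P`: for every sequence of events, `P(E_n) → 0` implies `Q(E_n) → 0`. -/
def AbsCont {S : MeasurableSpace Path} (Q P : events S → ℝ) : Prop :=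
  ∀ E : ℕ → events S, Tendsto (fun n => P (E n)) atTop (𝓝 0) →
    Tendsto (fun n => Q (E n)) atTop (𝓝 0)

/-- The Blackwell–Dubins property: `P` merges with every finitely additive probability `Q ≪ P`. -/
def BlackwellDubins {S : MeasurableSpace Path} (hS : ContainsCylinders S)
    (P : events S → ℝ) : Prop :=
  ∀ Q ∈ finAddProb (events S), AbsCont Q P → Merges hS P Q

end Merging

end

noncomputable section

namespace Merging

open MeasureTheory Filter Topology

/-! The pivot is density: every event is approximated in `P`-measure by finite unions of cylinders.
Extremality gives density (`cellsDense_of_extreme`). For an event `A`, subtract from `P(A ∩ ·)` an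
ultrafilter limit of the integrals of `P(A | cell)`. The difference ν vanishes on cylinders and |ν|
≤ P, so P ± ν are extensions with midpoint P and ν = 0. Evaluated at the complement of `A`, this
says that most cells lie almost inside or almost outside `A`. Density gives merging when Q ≪ P
(`mergesAlong_of_cellsDense`). The share Q/(P+Q) of the cells is a bounded martingale under P+Q, so
its second moment converges. Hence Q is close to the integral of the time-s share, uniformly over
unions of later cells, and by density and absolute continuity over all events. Gluing one
discriminating event from each discordant cell shows that these cells have small total Q-mass. No
countable additivity is needed. For the rest, a component of a mixture is dominated by a multiple of
P, hence ≪ P; and if P merges with a component that agrees with it on cylinders, the two coincide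
(`eq_of_mergesAlong`), which is extremality. -/

/-- A nonnegative set function that is additive on disjoint measurable sets. -/
structure IsFinAdd {Ω : Type*} [MeasurableSpace Ω] (p : Set Ω → ℝ) : Prop where
  nonneg : ∀ A, 0 ≤ p A
  add : ∀ A B, MeasurableSet A → MeasurableSet B → Disjoint A B → p (A ∪ B) = p A + p B

/-! ### Finitely additive set functions and finite partitions -/

namespace IsFinAdd

variable {Ω : Type*} [MeasurableSpace Ω] {p q : Set Ω → ℝ}

theorem empty (hp : IsFinAdd p) : p ∅ = 0 := by
  have := hp.add ∅ ∅ .empty .empty (by simp)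
  simp at this
  linarith

theorem inter_add_diff (hp : IsFinAdd p) {A B : Set Ω} (hA : MeasurableSet A)
    (hB : MeasurableSet B) : p (A ∩ B) + p (A \ B) = p A := by
  rw [← hp.add _ _ (hA.inter hB) (hA.diff hB) (Set.disjoint_sdiff_right.mono_left Set.inter_subset_right), Set.inter_union_sdiff]

theorem mono (hp : IsFinAdd p) {A B : Set Ω} (hA : MeasurableSet A) (hB : MeasurableSet B)
    (h : A ⊆ B) : p A ≤ p B := by
  have := hp.inter_add_diff hB hA
  rw [Set.inter_eq_self_of_subset_right h] at this
  linarith [hp.nonneg (B \ A)]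

theorem le_add_symmDiff (hp : IsFinAdd p) {A B : Set Ω} (hA : MeasurableSet A)
    (hB : MeasurableSet B) : p A ≤ p B + p (symmDiff A B) := by
  have h1 := hp.inter_add_diff hA hB
  have h2 := hp.mono (hA.inter hB) hB Set.inter_subset_right
  have h3 := hp.mono (hA.diff hB) (hA.symmDiff hB) (by
    rw [Set.symmDiff_def]; exact Set.subset_union_left)
  linarith

theorem fun_add (hp : IsFinAdd p) (hq : IsFinAdd q) : IsFinAdd (fun A => p A + q A) where
  nonneg A := add_nonneg (hp.nonneg A) (hq.nonneg A)
  add A B hA hB h := by simp only [hp.add A B hA hB h, hq.add A B hA hB h]; ring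

variable {ι : Type*} [Fintype ι] {f : Ω → ι}

theorem _root_.Merging.measurableSet_preimage_of_fibers
    (hf : ∀ i, MeasurableSet (f ⁻¹' {i})) (J : Set ι) : MeasurableSet (f ⁻¹' J) := by
  have : f ⁻¹' J = ⋃ i ∈ J, f ⁻¹' {i} := by ext; simp
  rw [this]
  exact MeasurableSet.biUnion J.to_countable fun i _ => hf i

theorem inter_preimage_eq_sum (hp : IsFinAdd p) (hf : ∀ i, MeasurableSet (f ⁻¹' {i})) {E : Set Ω}
    (hE : MeasurableSet E) (J : Finset ι) :
    p (E ∩ f ⁻¹' J) = ∑ i ∈ J, p (E ∩ f ⁻¹' {i}) := by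
  classical
  induction J using Finset.induction_on with
  | empty => simp [hp.empty]
  | insert i J hi ih =>
    rw [Finset.sum_insert hi, ← ih, ← hp.add _ _ (hE.inter (hf i))
      (hE.inter (measurableSet_preimage_of_fibers hf _)), ← Set.inter_union_distrib_left,
      ← Set.preimage_union, Finset.coe_insert, Set.insert_eq]
    refine Disjoint.mono Set.inter_subset_right Set.inter_subset_right
      (Disjoint.preimage f ?_)
    simpa using hi

theorem eq_sum_cells (hp : IsFinAdd p) (hf : ∀ i, MeasurableSet (f ⁻¹' {i})) {E : Set Ω}
    (hE : MeasurableSet E) : p E = ∑ i, p (E ∩ f ⁻¹' {i}) := by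
  rw [← hp.inter_preimage_eq_sum hf hE]; simp

theorem preimage_eq_sum (hp : IsFinAdd p) (hf : ∀ i, MeasurableSet (f ⁻¹' {i})) (J : Finset ι) :
    p (f ⁻¹' J) = ∑ i ∈ J, p (f ⁻¹' {i}) := by
  have := hp.inter_preimage_eq_sum hf .univ J
  simpa using this

end IsFinAdd

/-- A refining sequence of finite measurable partitions, given by the maps to the sets of cells. -/
structure IsRefining {Ω : Type*} [MeasurableSpace Ω] {ι : ℕ → Type*} (π : ∀ t, Ω → ι t) :
    Prop where
  meas : ∀ t i, MeasurableSet (π t ⁻¹' {i})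
  factor : ∀ s t, s ≤ t → ∃ ρ : ι t → ι s, π s = ρ ∘ π t

/-! ### Shares and discordant cells -/

section Partition

theorem preimage_inter_cell {Ω ι : Type*} (f : Ω → ι) (J : Set ι) (i : ι) [Decidable (i ∈ J)] :
    f ⁻¹' J ∩ f ⁻¹' {i} = if i ∈ J then f ⁻¹' {i} else ∅ := by
  split_ifs with h
  · ext x
    simp only [Set.mem_inter_iff, Set.mem_preimage, Set.mem_singleton_iff, and_iff_right_iff_imp]
    rintro rfl; exact h
  · ext x
    simp only [Set.mem_inter_iff, Set.mem_preimage, Set.mem_singleton_iff,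
      Set.mem_empty_iff_false, iff_false, not_and]
    rintro hx rfl; exact h hx

variable {Ω : Type*} [MeasurableSpace Ω] {ι : ℕ → Type*}
  {π : ∀ t, Ω → ι t} {p q : Set Ω → ℝ}

/-- The share of `q` in `p + q` on a set. -/
def share (p q : Set Ω → ℝ) (C : Set Ω) : ℝ := q C / (p C + q C)

theorem share_mem_Icc (hp : IsFinAdd p) (hq : IsFinAdd q) (C : Set Ω) :
    share p q C ∈ Set.Icc 0 1 :=
  ⟨div_nonneg (hq.nonneg _) (add_nonneg (hp.nonneg _) (hq.nonneg _)),
    div_le_one_of_le₀ (by linarith [hp.nonneg C]) (add_nonneg (hp.nonneg _) (hq.nonneg _))⟩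

theorem share_mul (hp : IsFinAdd p) (hq : IsFinAdd q) (C : Set Ω) :
    share p q C * (p C + q C) = q C := by
  rcases eq_or_ne (p C + q C) 0 with h | h
  · rw [h, mul_zero]
    linarith [hp.nonneg C, hq.nonneg C]
  · exact div_mul_cancel₀ _ h

/-- The cells at time `t` on which the conditional forecasts of `p` and `q` for some event differ
by more than `ε`. -/
def discordantCells (π : ∀ t, Ω → ι t) (p q : Set Ω → ℝ) (t : ℕ) (ε : ℝ) : Set (ι t) :=
  {i | ∃ E, MeasurableSet E ∧
    ε < |p (E ∩ π t ⁻¹' {i}) / p (π t ⁻¹' {i}) - q (E ∩ π t ⁻¹' {i}) / q (π t ⁻¹' {i})|}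

theorem exists_witness_of_discordant (hπ : IsRefining π) (hp : IsFinAdd p) (hq : IsFinAdd q)
    {t : ℕ} {ε : ℝ} {i : ι t} (hi : i ∈ discordantCells π p q t ε) :
    ∃ E, MeasurableSet E ∧ ε * (share p q (π t ⁻¹' {i}) * p (π t ⁻¹' {i})) ≤
      q (E ∩ π t ⁻¹' {i}) -
        share p q (π t ⁻¹' {i}) * (p (E ∩ π t ⁻¹' {i}) + q (E ∩ π t ⁻¹' {i})) := by
  obtain ⟨E, hE, h⟩ := hi
  set C := π t ⁻¹' {i} with hC
  have hCm : MeasurableSet C := hπ.meas t i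
  -- On a cell null for `p` or `q` the weight pq/(p+q) is zero, so the empty event suffices.
  rcases (hp.nonneg C).eq_or_lt with hp0 | hp0
  · exact ⟨∅, .empty, by simp [hp.empty, hq.empty, ← hp0]⟩
  rcases (hq.nonneg C).eq_or_lt with hq0 | hq0
  · exact ⟨∅, .empty, by simp [share, hp.empty, hq.empty, ← hq0]⟩
  have key : ∀ a b : ℝ, b - share p q C * (a + b) =
      (share p q C * p C) * (b / q C - a / p C) := by
    intro a b
    have : p C + q C ≠ 0 := by positivity
    unfold share
    field_simp
    ring
  have hw : 0 ≤ share p q C * p C := mul_nonneg (share_mem_Icc hp hq _).1 hp0.le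
  rcases lt_abs.1 h with h | h
  -- Passing to the complement flips the sign of the forecast difference.
  · refine ⟨Eᶜ, hE.compl, ?_⟩
    rw [key, mul_comm ε]
    refine mul_le_mul_of_nonneg_left ?_ hw
    have h1 : p (Eᶜ ∩ C) = p C - p (E ∩ C) := by
      rw [← hp.inter_add_diff hCm hE, Set.inter_comm C E, Set.sdiff_eq, Set.inter_comm C]; ring
    have h2 : q (Eᶜ ∩ C) = q C - q (E ∩ C) := by
      rw [← hq.inter_add_diff hCm hE, Set.inter_comm C E, Set.sdiff_eq, Set.inter_comm C]; ring
    rw [h1, h2, sub_div, sub_div, div_self hp0.ne', div_self hq0.ne']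
    linarith
  · refine ⟨E, hE, ?_⟩
    rw [key, mul_comm ε]
    exact mul_le_mul_of_nonneg_left (by linarith) hw

variable [∀ t, Fintype (ι t)]

/-- Each fine cell lies in a single coarse cell. This is the tower property behind the martingale
computations. -/
theorem IsFinAdd.sum_coarse_cells {ι κ : Type*} [Fintype ι] [Fintype κ] {f : Ω → ι} {g : Ω → κ}
    {ρ : κ → ι} (hp : IsFinAdd p) (hf : ∀ i, MeasurableSet (f ⁻¹' {i}))
    (hg : ∀ j, MeasurableSet (g ⁻¹' {j})) (hρ : f = ρ ∘ g) (h : ι → ℝ) {E : Set Ω}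
    (hE : MeasurableSet E) :
    ∑ i, h i * p (E ∩ f ⁻¹' {i}) = ∑ j, h (ρ j) * p (E ∩ g ⁻¹' {j}) := by
  classical
  have h1 : ∀ i j, p (E ∩ f ⁻¹' {i} ∩ g ⁻¹' {j}) = if i = ρ j then p (E ∩ g ⁻¹' {j}) else 0 := by
    intro i j
    split_ifs with hij
    · congr 1
      ext x
      simp only [hρ, hij, Set.mem_inter_iff, Set.mem_preimage, Set.mem_singleton_iff,
        Function.comp_apply]
      constructor
      · exact fun hx => ⟨hx.1.1, hx.2⟩
      · exact fun hx => ⟨⟨hx.1, by rw [hx.2]⟩, hx.2⟩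
    · convert hp.empty
      ext x
      simp only [hρ, Set.mem_inter_iff, Set.mem_preimage, Set.mem_singleton_iff,
        Function.comp_apply, Set.mem_empty_iff_false, iff_false]
      rintro ⟨⟨_, rfl⟩, rfl⟩
      exact hij rfl
  have h2 : ∀ i, h i * p (E ∩ f ⁻¹' {i}) = ∑ j, if i = ρ j then h i * p (E ∩ g ⁻¹' {j}) else 0 := by
    intro i
    rw [hp.eq_sum_cells hg (hE.inter (hf i)), Finset.mul_sum]
    simp [h1]
  simp only [h2]
  rw [Finset.sum_comm]
  simp

/-! ### Extremality and approximation by cells -/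

/-- The integral over `E` of the conditional probability of `A` given the cells of the partition
at time `t`. -/
def condIntegral (π : ∀ t, Ω → ι t) (p : Set Ω → ℝ) (A : Set Ω) (t : ℕ) (E : Set Ω) : ℝ :=
  ∑ i, p (A ∩ π t ⁻¹' {i}) / p (π t ⁻¹' {i}) * p (E ∩ π t ⁻¹' {i})

theorem IsFinAdd.cond_mem_Icc (hp : IsFinAdd p) {A C : Set Ω} (hA : MeasurableSet A)
    (hC : MeasurableSet C) : p (A ∩ C) / p C ∈ Set.Icc 0 1 :=
  ⟨div_nonneg (hp.nonneg _) (hp.nonneg _),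
    div_le_one_of_le₀ (hp.mono (hA.inter hC) hC Set.inter_subset_right) (hp.nonneg _)⟩

theorem condIntegral_mem_Icc (hπ : IsRefining π) (hp : IsFinAdd p) {A E : Set Ω}
    (hA : MeasurableSet A) (hE : MeasurableSet E) (t : ℕ) :
    condIntegral π p A t E ∈ Set.Icc 0 (p E) := by
  constructor
  · exact Finset.sum_nonneg fun i _ =>
      mul_nonneg (hp.cond_mem_Icc hA (hπ.meas t i)).1 (hp.nonneg _)
  · rw [hp.eq_sum_cells (hπ.meas t) hE]
    exact Finset.sum_le_sum fun i _ =>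
      mul_le_of_le_one_left (hp.nonneg _) (hp.cond_mem_Icc hA (hπ.meas t i)).2

theorem condIntegral_union (hπ : IsRefining π) (hp : IsFinAdd p) {A E F : Set Ω}
    (hE : MeasurableSet E) (hF : MeasurableSet F) (h : Disjoint E F) (t : ℕ) :
    condIntegral π p A t (E ∪ F) = condIntegral π p A t E + condIntegral π p A t F := by
  simp only [condIntegral, ← Finset.sum_add_distrib]
  refine Finset.sum_congr rfl fun i _ => ?_
  rw [Set.union_inter_distrib_right, hp.add _ _ (hE.inter (hπ.meas t i)) (hF.inter (hπ.meas t i))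
    (h.mono Set.inter_subset_left Set.inter_subset_left)]
  ring

theorem IsFinAdd.div_mul_cancel_of_inter (hp : IsFinAdd p) {A C : Set Ω} (hA : MeasurableSet A)
    (hC : MeasurableSet C) : p (A ∩ C) / p C * p C = p (A ∩ C) := by
  rcases eq_or_ne (p C) 0 with h | h
  · have := hp.mono (hA.inter hC) hC Set.inter_subset_right
    rw [h] at this ⊢
    simp [le_antisymm this (hp.nonneg _)]
  · exact div_mul_cancel₀ _ h

/-- Every event is approximated in `p` by unions of cells. -/
def CellsDense (π : ∀ t, Ω → ι t) (p : Set Ω → ℝ) : Prop :=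
  ∀ A, MeasurableSet A → ∀ ε > 0, ∃ t, ∃ J : Finset (ι t), p (symmDiff A (π t ⁻¹' J)) ≤ ε

theorem exists_preimage_eq_of_le (hπ : IsRefining π) {s t : ℕ} (h : s ≤ t) (J : Finset (ι s)) :
    ∃ K : Finset (ι t), π s ⁻¹' J = π t ⁻¹' K := by
  classical
  obtain ⟨ρ, hρ⟩ := hπ.factor s t h
  refine ⟨Finset.univ.filter fun j => ρ j ∈ J, ?_⟩
  ext x
  simp [hρ]

theorem condIntegral_preimage (hπ : IsRefining π) (hp : IsFinAdd p) {A : Set Ω}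
    (hA : MeasurableSet A) {s t : ℕ} (h : s ≤ t) (J : Finset (ι s)) :
    condIntegral π p A t (π s ⁻¹' J) = p (A ∩ π s ⁻¹' J) := by
  classical
  obtain ⟨K, hK⟩ := exists_preimage_eq_of_le hπ h J
  rw [hK, hp.inter_preimage_eq_sum (hπ.meas t) hA, condIntegral,
    ← Finset.sum_subset (Finset.subset_univ K)]
  · refine Finset.sum_congr rfl fun i hi => ?_
    rw [preimage_inter_cell, if_pos (by simpa using hi),
      hp.div_mul_cancel_of_inter hA (hπ.meas t i)]
  · intro i _ hi
    rw [preimage_inter_cell, if_neg (by simpa using hi), hp.empty, mul_zero]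

theorem exists_approx_of_condIntegral_compl (hπ : IsRefining π) (hp : IsFinAdd p) {A : Set Ω}
    (hA : MeasurableSet A) (t : ℕ) :
    ∃ J : Finset (ι t), p (symmDiff A (π t ⁻¹' J)) ≤ 2 * condIntegral π p A t Aᶜ := by
  classical
  -- Majority rule: keep the cells that `A` fills at least half. The error in a cell is then the
  -- minimum of the two parts a and b, at most 2ab/(a+b).
  refine ⟨Finset.univ.filter fun i => p (Aᶜ ∩ π t ⁻¹' {i}) ≤ p (A ∩ π t ⁻¹' {i}), ?_⟩
  set J : Finset (ι t) := Finset.univ.filter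
    fun i => p (Aᶜ ∩ π t ⁻¹' {i}) ≤ p (A ∩ π t ⁻¹' {i}) with hJ
  have hJm := measurableSet_preimage_of_fibers (hπ.meas t) (J : Set (ι t))
  rw [hp.eq_sum_cells (hπ.meas t) (hA.symmDiff hJm), condIntegral, Finset.mul_sum]
  refine Finset.sum_le_sum fun i _ => ?_
  have hsum : p (A ∩ π t ⁻¹' {i}) + p (Aᶜ ∩ π t ⁻¹' {i}) = p (π t ⁻¹' {i}) := by
    have := hp.inter_add_diff (hπ.meas t i) hA
    rwa [Set.inter_comm, Set.sdiff_eq, Set.inter_comm _ Aᶜ] at this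
  have key : ∀ a b : ℝ, 0 ≤ a → 0 ≤ b → min a b ≤ 2 * (a / (a + b) * b) := by
    intro a b ha hb
    rcases eq_or_lt_of_le ha with rfl | ha'
    · simp [hb]
    have hab : 0 < a + b := by linarith
    rw [div_mul_eq_mul_div, ← mul_div_assoc, le_div_iff₀ hab]
    rcases le_total a b with h | h
    · rw [min_eq_left h]; nlinarith
    · rw [min_eq_right h]; nlinarith
  refine le_trans ?_ (hsum ▸ key _ _ (hp.nonneg _) (hp.nonneg _))
  by_cases hi : i ∈ J
  · have h1 : symmDiff A (π t ⁻¹' J) ∩ π t ⁻¹' {i} = Aᶜ ∩ π t ⁻¹' {i} := by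
      ext x
      simp only [Set.mem_inter_iff, Set.mem_symmDiff, Set.mem_preimage, Set.mem_singleton_iff,
        Set.mem_compl_iff, and_congr_left_iff, Finset.mem_coe]
      rintro rfl
      tauto
    rw [h1, min_eq_right (by simpa [hJ] using hi)]
  · have h1 : symmDiff A (π t ⁻¹' J) ∩ π t ⁻¹' {i} = A ∩ π t ⁻¹' {i} := by
      ext x
      simp only [Set.mem_inter_iff, Set.mem_symmDiff, Set.mem_preimage, Set.mem_singleton_iff,
        and_congr_left_iff, Finset.mem_coe]
      rintro rfl
      tauto
    rw [h1, min_eq_left]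
    simp only [hJ, Finset.mem_filter, Finset.mem_univ, true_and, not_le] at hi
    exact hi.le

/-- If `p` is not a proper midpoint of two set functions that agree with it on the cells, then
every event is approximated by unions of cells. -/
theorem cellsDense_of_extreme (hπ : IsRefining π) (hp : IsFinAdd p)
    (hext : ∀ ν : Set Ω → ℝ,
      (∀ A B, MeasurableSet A → MeasurableSet B → Disjoint A B → ν (A ∪ B) = ν A + ν B) →
      (∀ A, MeasurableSet A → |ν A| ≤ p A) → (∀ t (J : Finset (ι t)), ν (π t ⁻¹' J) = 0) →
      ∀ A, MeasurableSet A → ν A = 0) : CellsDense π p := by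
  intro A hA ε hε
  -- Convergence in `t` is not known, so limits are taken along one ultrafilter, the same for all
  -- `E`, which preserves additivity. The value 0 off the events is a dummy.
  have hlim : ∀ E, ∃ l, MeasurableSet E → l ∈ Set.Icc 0 (p E) ∧
      Tendsto (fun t => condIntegral π p A t E) (hyperfilter ℕ) (𝓝 l) := by
    intro E
    by_cases hE : MeasurableSet E
    · obtain ⟨l, hl, h⟩ := (isCompact_Icc (a := (0 : ℝ)) (b := p E)).ultrafilter_le_nhds'
        ((hyperfilter ℕ).map fun t => condIntegral π p A t E)
        (Ultrafilter.mem_map.2 (Filter.univ_mem' fun t => condIntegral_mem_Icc hπ hp hA hE t))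
      exact ⟨l, fun _ => ⟨hl, h⟩⟩
    · exact ⟨0, fun h => absurd h hE⟩
  choose L hL using hlim
  have hle : (hyperfilter ℕ : Filter ℕ) ≤ atTop := Nat.hyperfilter_le_atTop
  have h0 := hext (fun E => p (A ∩ E) - L E) ?_ ?_ ?_ Aᶜ hA.compl
  · have h1 := (hL Aᶜ hA.compl).2
    simp only [Set.inter_compl_self, hp.empty, zero_sub, neg_eq_zero] at h0
    rw [h0] at h1
    obtain ⟨t, ht⟩ := (h1.eventually (gt_mem_nhds (half_pos hε))).exists
    obtain ⟨J, hJ⟩ := exists_approx_of_condIntegral_compl hπ hp hA t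
    exact ⟨t, J, by linarith⟩
  · intro E F hE hF h
    have h1 := ((hL E hE).2.add (hL F hF).2)
    simp only [← condIntegral_union hπ hp hE hF h] at h1
    simp only [tendsto_nhds_unique (hL _ (hE.union hF)).2 h1, Set.inter_union_distrib_left]
    rw [hp.add _ _ (hA.inter hE) (hA.inter hF)
      (h.mono Set.inter_subset_right Set.inter_subset_right)]
    ring
  · intro E hE
    have h1 := (hL E hE).1
    have h2 := hp.mono (hA.inter hE) hE Set.inter_subset_right
    have h3 := hp.nonneg (A ∩ E)
    exact abs_le.2 ⟨by linarith [h1.2], by linarith [h1.1]⟩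
  · intro s J
    have h1 := (hL _ (measurableSet_preimage_of_fibers (hπ.meas s) (J : Set (ι s)))).2
    -- On a union of time-s cells the integrals are constant from time s on, so the ultrafilter
    -- limit is that constant.
    have h2 : Tendsto (fun t => condIntegral π p A t (π s ⁻¹' J)) atTop
        (𝓝 (p (A ∩ π s ⁻¹' J))) := by
      refine tendsto_const_nhds.congr' ?_
      filter_upwards [eventually_ge_atTop s] with t ht
      exact (condIntegral_preimage hπ hp hA ht J).symm
    rw [tendsto_nhds_unique h1 (h2.mono_left hle), sub_self]

/-! ### The share martingale and uniform approximation of `q` -/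

/-- The second moment of the share of `q` in the cells at time `t`. -/
def energy (π : ∀ t, Ω → ι t) (p q : Set Ω → ℝ) (t : ℕ) : ℝ :=
  ∑ i, share p q (π t ⁻¹' {i}) * q (π t ⁻¹' {i})

theorem energy_le (hπ : IsRefining π) (hp : IsFinAdd p) (hq : IsFinAdd q) (t : ℕ) :
    energy π p q t ≤ q Set.univ := by
  rw [hq.eq_sum_cells (hπ.meas t) .univ]
  simp only [Set.univ_inter]
  exact Finset.sum_le_sum fun i _ =>
    mul_le_of_le_one_left (hq.nonneg _) (share_mem_Icc hp hq _).2

/-- Orthogonality of martingale increments: the cross moment of the two shares equals the earlier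
second moment. -/
theorem sum_sq_share_sub (hπ : IsRefining π) (hp : IsFinAdd p) (hq : IsFinAdd q) {s t : ℕ}
    {ρ : ι t → ι s} (hρ : π s = ρ ∘ π t) :
    ∑ j, (share p q (π t ⁻¹' {j}) - share p q (π s ⁻¹' {ρ j})) ^ 2 *
      (p (π t ⁻¹' {j}) + q (π t ⁻¹' {j})) = energy π p q t - energy π p q s := by
  have h1 : energy π p q s = ∑ j, share p q (π s ⁻¹' {ρ j}) * q (π t ⁻¹' {j}) := by
    have := hq.sum_coarse_cells (hπ.meas s) (hπ.meas t) hρ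
      (fun i => share p q (π s ⁻¹' {i})) .univ
    simpa [energy] using this
  have h2 : energy π p q s = ∑ j, share p q (π s ⁻¹' {ρ j}) ^ 2 *
      (p (π t ⁻¹' {j}) + q (π t ⁻¹' {j})) := by
    have := (hp.fun_add hq).sum_coarse_cells (hπ.meas s) (hπ.meas t) hρ
      (fun i => share p q (π s ⁻¹' {i}) ^ 2) .univ
    simp only [Set.univ_inter] at this
    rw [← this, energy]
    refine Finset.sum_congr rfl fun i _ => ?_
    rw [sq, mul_assoc, share_mul hp hq]
  -- Expands the square; the doubled term is rewritten as the cross moment, the last as the moment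
  -- of the coarse share.
  have h3 : energy π p q t - energy π p q s =
      energy π p q t - 2 * energy π p q s + energy π p q s := by ring
  rw [h3]
  nth_rewrite 2 [h2]
  rw [h1, energy, Finset.mul_sum, ← Finset.sum_sub_distrib, ← Finset.sum_add_distrib]
  refine Finset.sum_congr rfl fun j _ => ?_
  have := share_mul hp hq (π t ⁻¹' {j})
  linear_combination (share p q (π t ⁻¹' {j}) - 2 * share p q (π s ⁻¹' {ρ j})) * this

theorem energy_mono (hπ : IsRefining π) (hp : IsFinAdd p) (hq : IsFinAdd q) :
    Monotone (energy π p q) := by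
  intro s t h
  obtain ⟨ρ, hρ⟩ := hπ.factor s t h
  rw [← sub_nonneg, ← sum_sq_share_sub hπ hp hq hρ]
  exact Finset.sum_nonneg fun j _ =>
    mul_nonneg (sq_nonneg _) (add_nonneg (hp.nonneg _) (hq.nonneg _))

theorem exists_energy_sub_le (hπ : IsRefining π) (hp : IsFinAdd p) (hq : IsFinAdd q) {η : ℝ}
    (hη : 0 < η) : ∃ s₀, ∀ s t, s₀ ≤ s → energy π p q t - energy π p q s ≤ η := by
  have hb : BddAbove (Set.range (energy π p q)) :=
    ⟨q Set.univ, by rintro _ ⟨t, rfl⟩; exact energy_le hπ hp hq t⟩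
  obtain ⟨s₀, hs₀⟩ := exists_lt_of_lt_ciSup (sub_lt_self (⨆ t, energy π p q t) hη)
  refine ⟨s₀, fun s t hs => ?_⟩
  have h1 := le_ciSup hb t
  have h2 := energy_mono hπ hp hq hs
  linarith

/-- The deviation of `q` on `E` from its conditional approximation at time `t`. -/
def deviation (π : ∀ t, Ω → ι t) (p q : Set Ω → ℝ) (t : ℕ) (E : Set Ω) : ℝ :=
  q E - ∑ i, share p q (π t ⁻¹' {i}) * (p (E ∩ π t ⁻¹' {i}) + q (E ∩ π t ⁻¹' {i}))

/-- On a union of time-t cells the deviation is a partial sum of share increments against p+q. The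
inequality x ≤ x²/(4δ) + δ trades it for the energy gain. -/
theorem deviation_preimage_le (hπ : IsRefining π) (hp : IsFinAdd p) (hq : IsFinAdd q) {s t : ℕ}
    (h : s ≤ t) (J : Finset (ι t)) {δ : ℝ} (hδ : 0 < δ) :
    deviation π p q s (π t ⁻¹' J) ≤
      (energy π p q t - energy π p q s) / (4 * δ) + δ * (p Set.univ + q Set.univ) := by
  classical
  obtain ⟨ρ, hρ⟩ := hπ.factor s t h
  have hJ := measurableSet_preimage_of_fibers (hπ.meas t) (J : Set (ι t))
  set r : ι t → ℝ := fun j => p (π t ⁻¹' {j}) + q (π t ⁻¹' {j}) with hr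
  have hr0 : ∀ j, 0 ≤ r j := fun j => add_nonneg (hp.nonneg _) (hq.nonneg _)
  set x : ι t → ℝ := fun j => share p q (π t ⁻¹' {j}) - share p q (π s ⁻¹' {ρ j}) with hx
  have hsum : deviation π p q s (π t ⁻¹' J) = ∑ j ∈ J, x j * r j := by
    have h1 := (hp.fun_add hq).sum_coarse_cells (hπ.meas s) (hπ.meas t) hρ
      (fun i => share p q (π s ⁻¹' {i})) hJ
    rw [deviation, h1, hq.preimage_eq_sum (hπ.meas t),
      ← Finset.sum_subset (Finset.subset_univ J), ← Finset.sum_sub_distrib]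
    · refine Finset.sum_congr rfl fun j hj => ?_
      rw [preimage_inter_cell, if_pos (by simpa using hj)]
      linear_combination -share_mul hp hq (π t ⁻¹' {j})
    · intro j _ hj
      rw [preimage_inter_cell, if_neg (by simpa using hj), hp.empty, hq.empty, add_zero, mul_zero]
  have htot : p Set.univ + q Set.univ = ∑ j, r j := by
    have := (hp.fun_add hq).eq_sum_cells (hπ.meas t) .univ
    simpa only [Set.univ_inter] using this
  rw [hsum, htot, ← sum_sq_share_sub hπ hp hq hρ, Finset.sum_div, Finset.mul_sum,
    ← Finset.sum_add_distrib]
  have hterm : ∀ j, x j * r j ≤ x j ^ 2 * r j / (4 * δ) + δ * r j := by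
    intro j
    have : x j ≤ x j ^ 2 / (4 * δ) + δ := by
      rw [← sub_le_iff_le_add, le_div_iff₀ (by positivity)]
      nlinarith [sq_nonneg (x j - 2 * δ)]
    have := mul_le_mul_of_nonneg_right this (hr0 j)
    calc _ ≤ _ := this
      _ = _ := by ring
  refine (Finset.sum_le_sum fun j _ => hterm j).trans
    (Finset.sum_le_sum_of_subset_of_nonneg (Finset.subset_univ J) fun j _ _ => ?_)
  have := hr0 j
  positivity

theorem deviation_le_add_symmDiff (hπ : IsRefining π) (hp : IsFinAdd p) (hq : IsFinAdd q)
    {E F : Set Ω} (hE : MeasurableSet E) (hF : MeasurableSet F) (t : ℕ) :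
    deviation π p q t E ≤
      deviation π p q t F + (p (symmDiff E F) + 2 * q (symmDiff E F)) := by
  have h1 := hq.le_add_symmDiff hE hF
  have h2 : ∑ i, share p q (π t ⁻¹' {i}) * (p (F ∩ π t ⁻¹' {i}) + q (F ∩ π t ⁻¹' {i})) ≤
      ∑ i, share p q (π t ⁻¹' {i}) * (p (E ∩ π t ⁻¹' {i}) + q (E ∩ π t ⁻¹' {i})) +
        (p (symmDiff E F) + q (symmDiff E F)) := by
    have h3 := (hp.fun_add hq).eq_sum_cells (hπ.meas t) (hE.symmDiff hF)
    rw [h3, ← Finset.sum_add_distrib]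
    refine Finset.sum_le_sum fun i _ => ?_
    have h4 := (hp.fun_add hq).le_add_symmDiff (hF.inter (hπ.meas t i)) (hE.inter (hπ.meas t i))
    rw [← Set.inter_symmDiff_distrib_right, symmDiff_comm F E] at h4
    have h5 := share_mem_Icc hp hq (π t ⁻¹' {i})
    have h6 := (hp.fun_add hq).nonneg (symmDiff E F ∩ π t ⁻¹' {i})
    have h7 := mul_le_mul_of_nonneg_left h4 h5.1
    have h8 := mul_le_of_le_one_left h6 h5.2
    linarith
  unfold deviation
  linarith

/-- Absolute continuity in the `ε`-`δ` form. -/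
def UnifAbsCont (q p : Set Ω → ℝ) : Prop :=
  ∀ ε > 0, ∃ δ > 0, ∀ E, MeasurableSet E → p E < δ → q E < ε

/-- The time `s₀` comes from the energy alone, before `E` is chosen; the time at which cells
approximate `E` enters only through a later refinement. Energy gain, δ-term, `p`-error and doubled
`q`-error each cost at most κ/4. -/
theorem exists_deviation_le (hπ : IsRefining π) (hp : IsFinAdd p) (hq : IsFinAdd q)
    (hd : CellsDense π p) (hqp : UnifAbsCont q p) {κ : ℝ} (hκ : 0 < κ) :
    ∃ s₀, ∀ s ≥ s₀, ∀ E, MeasurableSet E → deviation π p q s E ≤ κ := by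
  set T := p Set.univ + q Set.univ + 1 with hT
  have hT0 : 0 < T := by linarith [hp.nonneg Set.univ, hq.nonneg Set.univ]
  set δ := κ / (4 * T) with hδ
  have hδ0 : 0 < δ := by positivity
  obtain ⟨s₀, hs₀⟩ := exists_energy_sub_le hπ hp hq (η := κ / 4 * (4 * δ)) (by positivity)
  refine ⟨s₀, fun s hs E hE => ?_⟩
  obtain ⟨δ', hδ', hac⟩ := hqp (κ / 8) (by positivity)
  obtain ⟨u, J, hJ⟩ := hd E hE (min (δ' / 2) (κ / 4)) (by positivity)
  obtain ⟨K, hK⟩ := exists_preimage_eq_of_le hπ (le_max_right s u) J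
  rw [hK] at hJ
  have hKm := measurableSet_preimage_of_fibers (hπ.meas (max s u)) (K : Set (ι (max s u)))
  have h1 := deviation_le_add_symmDiff hπ hp hq hE hKm s
  have h2 := deviation_preimage_le hπ hp hq (le_max_left s u) K hδ0
  have h3 := hac _ (hE.symmDiff hKm) (by linarith [min_le_left (δ' / 2) (κ / 4)])
  have h4 : (energy π p q (max s u) - energy π p q s) / (4 * δ) ≤ κ / 4 :=
    (div_le_iff₀ (by positivity)).2 (hs₀ s _ hs)
  have h5 : δ * (p Set.univ + q Set.univ) ≤ κ / 4 := by
    have : δ * T = κ / 4 := by rw [hδ]; field_simp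
    rw [← this]
    exact mul_le_mul_of_nonneg_left (by linarith) hδ0.le
  have := min_le_right (δ' / 2) (κ / 4)
  linarith

/-! ### Merging along the partitions -/

/-- Forecasts of `p` and `q` given the cells merge in `q`-probability. -/
def MergesAlong (π : ∀ t, Ω → ι t) (p q : Set Ω → ℝ) : Prop :=
  ∀ ε > 0, Tendsto (fun t => q (π t ⁻¹' discordantCells π p q t ε)) atTop (𝓝 0)

theorem deviation_eq_sum (hπ : IsRefining π) (hq : IsFinAdd q)
    {E : Set Ω} (hE : MeasurableSet E) (t : ℕ) :
    deviation π p q t E = ∑ i, (q (E ∩ π t ⁻¹' {i}) -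
      share p q (π t ⁻¹' {i}) * (p (E ∩ π t ⁻¹' {i}) + q (E ∩ π t ⁻¹' {i}))) := by
  rw [Finset.sum_sub_distrib, ← hq.eq_sum_cells (hπ.meas t) hE, deviation]

/-- Cells are disjoint, so the witnesses of the separate cells glue into one event whose deviation
is the sum of theirs. -/
theorem sum_discordant_le (hπ : IsRefining π) (hp : IsFinAdd p) (hq : IsFinAdd q)
    {t : ℕ} {ε κ : ℝ} (h : ∀ E, MeasurableSet E → deviation π p q t E ≤ κ)
    (J : Finset (ι t)) (hJ : (J : Set (ι t)) ⊆ discordantCells π p q t ε) :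
    ε * ∑ i ∈ J, share p q (π t ⁻¹' {i}) * p (π t ⁻¹' {i}) ≤ κ := by
  classical
  choose! E hE hEw using fun i (hi : i ∈ J) => exists_witness_of_discordant hπ hp hq (hJ hi)
  set F : Set Ω := ⋃ i ∈ J, E i ∩ π t ⁻¹' {i} with hF
  have hFm : MeasurableSet F :=
    Finset.measurableSet_biUnion J fun i hi => (hE i hi).inter (hπ.meas t i)
  have hFi : ∀ i, F ∩ π t ⁻¹' {i} = if i ∈ J then E i ∩ π t ⁻¹' {i} else ∅ := by
    intro i
    ext x
    split_ifs with hi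
    · simp only [hF, Set.mem_inter_iff, Set.mem_iUnion, Set.mem_preimage, Set.mem_singleton_iff]
      constructor
      · rintro ⟨⟨j, hj, hx, rfl⟩, rfl⟩
        exact ⟨hx, rfl⟩
      · rintro ⟨hx, rfl⟩
        exact ⟨⟨_, hi, hx, rfl⟩, rfl⟩
    · simp only [hF, Set.mem_inter_iff, Set.mem_iUnion, Set.mem_preimage, Set.mem_singleton_iff,
        Set.mem_empty_iff_false, iff_false]
      rintro ⟨⟨j, hj, hx, rfl⟩, rfl⟩
      exact hi hj
  refine le_trans ?_ (h F hFm)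
  rw [deviation_eq_sum hπ hq hFm, ← Finset.sum_subset (Finset.subset_univ J), Finset.mul_sum]
  · refine Finset.sum_le_sum fun i hi => ?_
    rw [hFi, if_pos hi]
    exact hEw i hi
  · intro i _ hi
    rw [hFi, if_neg hi, hp.empty, hq.empty]
    simp

theorem min_le_two_mul_share (hp : IsFinAdd p) (hq : IsFinAdd q) (C : Set Ω) :
    min (p C) (q C) ≤ 2 * (share p q C * p C) := by
  rcases (add_nonneg (hp.nonneg C) (hq.nonneg C)).eq_or_lt with h | h
  · have h1 := hp.nonneg C
    have h2 := hq.nonneg C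
    have : p C = 0 := by linarith
    simp [this, h2]
  · unfold share
    rw [div_mul_eq_mul_div, ← mul_div_assoc, le_div_iff₀ h]
    have h1 := hp.nonneg C
    have h2 := hq.nonneg C
    rcases le_total (p C) (q C) with h3 | h3
    · rw [min_eq_left h3]; nlinarith
    · rw [min_eq_right h3]; nlinarith

theorem mergesAlong_of_cellsDense (hπ : IsRefining π) (hp : IsFinAdd p) (hq : IsFinAdd q)
    (hd : CellsDense π p) (hqp : UnifAbsCont q p) : MergesAlong π p q := by
  classical
  intro ε hε
  rw [Metric.tendsto_atTop]
  intro ε' hε'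
  obtain ⟨δ, hδ, hac⟩ := hqp (ε' / 2) (half_pos hε')
  set m := min δ (ε' / 2) / 2 with hm
  have hm0 : 0 < m := by positivity
  obtain ⟨s₀, hs₀⟩ := exists_deviation_le hπ hp hq hd hqp (κ := ε * (m / 2)) (by positivity)
  refine ⟨s₀, fun t ht => ?_⟩
  rw [Real.dist_eq, sub_zero, abs_of_nonneg (hq.nonneg _)]
  set J : Finset (ι t) := Finset.univ.filter fun i => i ∈ discordantCells π p q t ε with hJ
  have hJc : (discordantCells π p q t ε) = (J : Set (ι t)) := by ext; simp [hJ]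
  -- Only the sum of min(p, q) is controlled. Where p ≤ q it bounds the `p`-mass, and absolute
  -- continuity bounds the `q`-mass; elsewhere it bounds the `q`-mass directly.
  set J₁ := J.filter fun i => p (π t ⁻¹' {i}) ≤ q (π t ⁻¹' {i}) with hJ₁
  set J₂ := J.filter fun i => ¬ p (π t ⁻¹' {i}) ≤ q (π t ⁻¹' {i}) with hJ₂
  have hbound : ∀ K ⊆ J, ∑ i ∈ K, min (p (π t ⁻¹' {i})) (q (π t ⁻¹' {i})) ≤ m := by
    intro K hK
    have h1 := sum_discordant_le hπ hp hq (ε := ε) (hs₀ t ht) K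
      (by rw [hJc]; exact_mod_cast hK)
    have h2 := le_of_mul_le_mul_left h1 hε
    have h3 := Finset.sum_le_sum fun i (_ : i ∈ K) => min_le_two_mul_share hp hq (π t ⁻¹' {i})
    rw [← Finset.mul_sum] at h3
    linarith
  have h1 : q (π t ⁻¹' J₁) < ε' / 2 := by
    refine hac _ (measurableSet_preimage_of_fibers (hπ.meas t) _) ?_
    have := hbound J₁ (Finset.filter_subset _ _)
    rw [Finset.sum_congr rfl fun i hi => min_eq_left (Finset.mem_filter.1 hi).2,
      ← hp.preimage_eq_sum (hπ.meas t)] at this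
    linarith [min_le_left δ (ε' / 2)]
  have h2 : q (π t ⁻¹' J₂) ≤ m := by
    have := hbound J₂ (Finset.filter_subset _ _)
    rwa [Finset.sum_congr rfl fun i hi => min_eq_right (le_of_not_ge (Finset.mem_filter.1 hi).2),
      ← hq.preimage_eq_sum (hπ.meas t)] at this
  have h3 : q (π t ⁻¹' J) = q (π t ⁻¹' J₁) + q (π t ⁻¹' J₂) := by
    rw [hq.preimage_eq_sum (hπ.meas t), hq.preimage_eq_sum (hπ.meas t),
      hq.preimage_eq_sum (hπ.meas t), Finset.sum_filter_add_sum_filter_not]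
  rw [hJc, h3]
  have := min_le_right δ (ε' / 2)
  linarith

/-- If `p` and `q` agree on the cells and `p` merges with `q`, then `p` and `q` agree. -/
theorem eq_of_mergesAlong (hπ : IsRefining π) (hp : IsFinAdd p) (hq : IsFinAdd q)
    (hpq : ∀ t i, p (π t ⁻¹' {i}) = q (π t ⁻¹' {i})) (h : MergesAlong π p q)
    {E : Set Ω} (hE : MeasurableSet E) : p E = q E := by
  classical
  rw [← sub_eq_zero, ← abs_eq_zero]
  refine le_antisymm (le_of_forall_pos_le_add fun η hη => ?_) (abs_nonneg _)
  set ε := η / (2 * (q Set.univ + 1)) with hε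
  have hu := hq.nonneg Set.univ
  have hε0 : 0 < ε := by positivity
  obtain ⟨t, ht⟩ := ((h ε hε0).eventually (gt_mem_nhds (half_pos hη))).exists
  set J : Finset (ι t) := Finset.univ.filter fun i => i ∈ discordantCells π p q t ε with hJ
  have hJc : (discordantCells π p q t ε) = (J : Set (ι t)) := by ext; simp [hJ]
  rw [hJc, hq.preimage_eq_sum (hπ.meas t)] at ht
  -- As the cell masses agree, a concordant cell contributes at most ε times its mass and a
  -- discordant one at most its mass.
  have hcell : ∀ i, |p (E ∩ π t ⁻¹' {i}) - q (E ∩ π t ⁻¹' {i})| ≤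
      ε * q (π t ⁻¹' {i}) + if i ∈ J then q (π t ⁻¹' {i}) else 0 := by
    intro i
    have hC := hπ.meas t i
    have e1 := hp.div_mul_cancel_of_inter hE hC
    have e2 := hq.div_mul_cancel_of_inter hE hC
    have b1 := hp.cond_mem_Icc hE hC
    have b2 := hq.cond_mem_Icc hE hC
    have hq0 := hq.nonneg (π t ⁻¹' {i})
    rw [hpq] at e1 b1
    rw [← e1, ← e2, ← sub_mul, abs_mul, abs_of_nonneg hq0]
    split_ifs with hi
    · have : |p (E ∩ π t ⁻¹' {i}) / q (π t ⁻¹' {i}) - q (E ∩ π t ⁻¹' {i}) / q (π t ⁻¹' {i})| ≤ 1 :=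
        abs_le.2 ⟨by linarith [b1.1, b2.2], by linarith [b1.2, b2.1]⟩
      have := mul_le_of_le_one_left hq0 this
      have := mul_nonneg hε0.le hq0
      linarith
    · rw [add_zero]
      refine mul_le_mul_of_nonneg_right ?_ hq0
      by_contra hlt
      refine hi (by
        simp only [hJ, Finset.mem_filter, Finset.mem_univ, true_and]
        exact ⟨E, hE, by rw [hpq]; exact not_le.1 hlt⟩)
  have hsum : |p E - q E| ≤ ε * q Set.univ + ∑ i ∈ J, q (π t ⁻¹' {i}) := by
    rw [hp.eq_sum_cells (hπ.meas t) hE, hq.eq_sum_cells (hπ.meas t) hE,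
      hq.eq_sum_cells (hπ.meas t) .univ, ← Finset.sum_sub_distrib]
    refine (Finset.abs_sum_le_sum_abs _ _).trans ((Finset.sum_le_sum fun i _ => hcell i).trans ?_)
    simp [Finset.sum_add_distrib, Finset.mul_sum]
  have hε1 : ε * (q Set.univ + 1) = η / 2 := by rw [hε]; field_simp
  linarith [mul_add ε (q Set.univ) 1]

end Partition

/-! ### Transfer to path space -/

/-- The first `t` coordinates of a path. -/
def word (t : ℕ) (ω : Path) : Fin t → Bool := fun i => ω i

theorem cyl_eq_preimage_word (ω : Path) (t : ℕ) : cyl ω t = word t ⁻¹' {word t ω} := by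
  ext y
  simp only [PiNat.mem_cylinder_iff, Set.mem_preimage, Set.mem_singleton_iff, word, funext_iff]
  exact ⟨fun h i => h i i.2, fun h i hi => h ⟨i, hi⟩⟩

theorem exists_word_eq {t : ℕ} (w : Fin t → Bool) : ∃ ω, word t ω = w :=
  ⟨fun n => if h : n < t then w ⟨n, h⟩ else false, by ext i; simp [word]⟩

theorem word_factor {s t : ℕ} (h : s ≤ t) :
    ∃ ρ : (Fin t → Bool) → (Fin s → Bool), word s = ρ ∘ word t :=
  ⟨fun w i => w (Fin.castLE h i), rfl⟩

/-- Two events determined by finitely many coordinates are both determined by the longer prefix, so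
unions stay of this form. -/
theorem exists_preimage_word_of_mem_cylAlgebra {A : Set Path} (hA : A ∈ cylAlgebra) :
    ∃ t, ∃ J : Set (Fin t → Bool), A = word t ⁻¹' J := by
  induction hA with
  | base s hs => obtain ⟨ω, t, rfl⟩ := hs; exact ⟨t, _, cyl_eq_preimage_word ω t⟩
  | empty => exact ⟨0, ∅, by simp⟩
  | compl s _ ih =>
    obtain ⟨t, J, rfl⟩ := ih
    exact ⟨t, Jᶜ, rfl⟩
  | union s t _ _ ihs iht =>
    obtain ⟨a, J, rfl⟩ := ihs
    obtain ⟨b, K, rfl⟩ := iht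
    obtain ⟨ρ, hρ⟩ := word_factor (le_max_left a b)
    obtain ⟨σ, hσ⟩ := word_factor (le_max_right a b)
    exact ⟨max a b, ρ ⁻¹' J ∪ σ ⁻¹' K, by rw [hρ, hσ]; rfl⟩

theorem cyl_mem_cylAlgebra (ω : Path) (t : ℕ) : cyl ω t ∈ cylAlgebra :=
  generateSetAlgebra.base _ ⟨ω, t, rfl⟩

variable {S : MeasurableSpace Path}

theorem isRefining_word (hS : ContainsCylinders S) : IsRefining word where
  meas t w := by
    obtain ⟨ω, rfl⟩ := exists_word_eq w
    rw [← cyl_eq_preimage_word]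
    exact hS ω t
  factor _ _ h := word_factor h

open Classical in
/-- The extension by zero of a set function on the events to all sets of paths. -/
def extendZero (P : events S → ℝ) (A : Set Path) : ℝ :=
  if h : A ∈ events S then P ⟨A, h⟩ else 0

theorem extendZero_of_mem (P : events S → ℝ) {A : Set Path} (h : A ∈ events S) :
    extendZero P A = P ⟨A, h⟩ := dif_pos h

theorem isFinAdd_extendZero {P : events S → ℝ} (hP : P ∈ finAddProb (events S)) :
    IsFinAdd (extendZero P) where
  nonneg A := by
    unfold extendZero
    split_ifs
    exacts [hP.1 _, le_rfl]
  add A B hA hB h := by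
    rw [extendZero_of_mem P hA, extendZero_of_mem P hB, extendZero_of_mem P (hA.union hB)]
    exact hP.2.2 _ _ _ h rfl

theorem condProb_eq (hS : ContainsCylinders S) (P : events S → ℝ) (ω : Path) (t : ℕ)
    (E : events S) :
    condProb hS P ω t E = extendZero P (E ∩ word t ⁻¹' {word t ω}) /
      extendZero P (word t ⁻¹' {word t ω}) := by
  rw [condProb, ← cyl_eq_preimage_word, extendZero_of_mem P (hS ω t),
    extendZero_of_mem P (MeasurableSet.inter E.2 (hS ω t))]

theorem setOf_forecastDist_gt (hS : ContainsCylinders S) {P Q : events S → ℝ}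
    (hP : P ∈ finAddProb (events S)) (hQ : Q ∈ finAddProb (events S)) (t : ℕ) (ε : ℝ) :
    {ω | forecastDist hS P Q ω t > ε} =
      word t ⁻¹' discordantCells word (extendZero P) (extendZero Q) t ε := by
  ext ω
  -- Without boundedness the real supremum would default to 0; with it, exceeding ε is witnessed by
  -- a single event.
  have hbdd : BddAbove (Set.range fun E : events S =>
      |condProb hS P ω t E - condProb hS Q ω t E|) := by
    refine ⟨1, ?_⟩
    rintro _ ⟨E, rfl⟩
    have hC := (isRefining_word hS).meas t (word t ω)
    have h1 := (isFinAdd_extendZero hP).cond_mem_Icc E.2 hC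
    have h2 := (isFinAdd_extendZero hQ).cond_mem_Icc E.2 hC
    simp only [condProb_eq]
    exact abs_le.2 ⟨by linarith [h1.1, h2.2], by linarith [h1.2, h2.1]⟩
  have : Nonempty (events S) := ⟨⟨∅, MeasurableSet.empty⟩⟩
  simp only [Set.mem_ofPred_eq, Set.mem_preimage, discordantCells, forecastDist, gt_iff_lt]
  rw [lt_ciSup_iff hbdd]
  simp only [condProb_eq]
  exact ⟨fun ⟨E, h⟩ => ⟨E, E.2, h⟩, fun ⟨E, hE, h⟩ => ⟨⟨E, hE⟩, h⟩⟩

theorem merges_iff_mergesAlong (hS : ContainsCylinders S) {P Q : events S → ℝ}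
    (hP : P ∈ finAddProb (events S)) (hQ : Q ∈ finAddProb (events S)) :
    Merges hS P Q ↔ MergesAlong word (extendZero P) (extendZero Q) := by
  refine forall₂_congr fun ε _ => ?_
  simp only [← setOf_forecastDist_gt hS hP hQ, extendZero_of_mem Q (forecastDist_event hS P Q _ ε)]

theorem AbsCont.unifAbsCont {P Q : events S → ℝ} (hP : P ∈ finAddProb (events S))
    (h : AbsCont Q P) :
    UnifAbsCont (extendZero Q) (extendZero P) := by
  intro ε hε
  by_contra! hcon
  -- Counterexamples for δ = 1/(n+1) form a sequence that contradicts the sequential definition.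
  choose E hE hPE hQE using fun n : ℕ => hcon (1 / ((n : ℝ) + 1)) Nat.one_div_pos_of_nat
  have h1 : Tendsto (fun n => P ⟨E n, hE n⟩) atTop (𝓝 0) := by
    refine squeeze_zero (fun n => hP.1 _) (fun n => ?_) tendsto_one_div_add_atTop_nhds_zero_nat
    rw [← extendZero_of_mem P (hE n)]
    exact (hPE n).le
  obtain ⟨n, hn⟩ := ((h _ h1).eventually (gt_mem_nhds hε)).exists
  have := hQE n
  rw [extendZero_of_mem Q (hE n)] at this
  linarith

theorem cellsDense_of_mem_extremePoints (hS : ContainsCylinders S) {P : events S → ℝ}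
    (hP : P ∈ finAddProb (events S))
    (h : P ∈ Set.extremePoints ℝ (extensions (cylAlgebra_subset_events hS)
      (restrict (cylAlgebra_subset_events hS) P))) :
    CellsDense word (extendZero P) := by
  classical
  refine cellsDense_of_extreme (isRefining_word hS) (isFinAdd_extendZero hP) ?_
  intro ν hadd habs hzero A hA
  have hν1 : ∀ B : events S, (B : Set Path) ∈ cylAlgebra → ν B = 0 := by
    intro B hB
    obtain ⟨t, J, hJ⟩ := exists_preimage_word_of_mem_cylAlgebra hB
    have := hzero t J.toFinset
    rwa [Set.coe_toFinset, ← hJ] at this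
  have huniv : (Set.univ : Set Path) ∈ cylAlgebra := by
    have := cyl_mem_cylAlgebra (fun _ => false) 0
    rwa [cyl, PiNat.cylinder_zero] at this
  -- P ± ν are extensions: |ν| ≤ P gives nonnegativity, and vanishing on the cylinder algebra keeps
  -- the total mass and the restriction.
  have hmem : ∀ c : ℝ, |c| = 1 → (fun B : events S => P B + c * ν B) ∈
      extensions (cylAlgebra_subset_events hS) (restrict (cylAlgebra_subset_events hS) P) := by
    intro c hc
    refine ⟨⟨fun B => ?_, fun B hB => ?_, fun B C D hBC hD => ?_⟩, ?_⟩
    · have h1 := habs B B.2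
      rw [extendZero_of_mem P B.2] at h1
      have h2 := neg_abs_le (c * ν B)
      rw [abs_mul, hc, one_mul] at h2
      change 0 ≤ P B + c * ν B
      change |ν B| ≤ P B at h1
      linarith
    · simp only
      rw [hP.2.1 B hB, hν1 B (hB ▸ huniv)]
      ring
    · simp only
      rw [hP.2.2 B C D hBC hD, hD, hadd B C B.2 C.2 hBC]
      ring
    · funext B
      simp only [restrict]
      rw [hν1 ⟨B, cylAlgebra_subset_events hS B.2⟩ B.2]
      ring
  have hseg : P ∈ openSegment ℝ (fun B : events S => P B + 1 * ν B)
      (fun B : events S => P B + (-1) * ν B) := by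
    refine ⟨1 / 2, 1 / 2, by norm_num, by norm_num, by norm_num, ?_⟩
    funext B
    simp only [Pi.add_apply, Pi.smul_apply, smul_eq_mul]
    ring
  have := h.2 (hmem 1 (by simp)) (hmem (-1) (by simp)) hseg
  have := congrFun this ⟨A, hA⟩
  simp only at this
  linarith

theorem AbsCont.of_le_mul {P Q : events S → ℝ} (hQ : ∀ A, 0 ≤ Q A) {c : ℝ}
    (h : ∀ A, Q A ≤ c * P A) : AbsCont Q P := fun E hE =>
  squeeze_zero (fun n => hQ _) (fun n => h _) (by simpa using hE.const_mul c)

/-- A component of weight `a` is at most a⁻¹P, hence absolutely continuous with respect to P. -/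
theorem BlackwellDubins.merges_of_mixture {hS : ContainsCylinders S} {P Q R : events S → ℝ}
    (h : BlackwellDubins hS P) (hQ : Q ∈ finAddProb (events S)) (hR : R ∈ finAddProb (events S))
    {a b : ℝ} (ha : 0 < a) (hb : 0 < b) (hPQR : P = a • Q + b • R) : Merges hS P Q := by
  refine h Q hQ (AbsCont.of_le_mul hQ.1 (c := a⁻¹) fun A => ?_)
  rw [le_inv_mul_iff₀ ha, hPQR]
  simpa using mul_nonneg hb.le (hR.1 A)

theorem eq_of_mem_extensions_of_merges (hS : ContainsCylinders S) {P Q : events S → ℝ}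
    (hP : P ∈ finAddProb (events S))
    (hQ : Q ∈ extensions (cylAlgebra_subset_events hS)
      (restrict (cylAlgebra_subset_events hS) P)) (h : Merges hS P Q) : P = Q := by
  funext E
  have hcell : ∀ t (w : Fin t → Bool),
      extendZero P (word t ⁻¹' {w}) = extendZero Q (word t ⁻¹' {w}) := by
    intro t w
    obtain ⟨ω, rfl⟩ := exists_word_eq w
    rw [← cyl_eq_preimage_word, extendZero_of_mem P (hS ω t), extendZero_of_mem Q (hS ω t)]
    exact (congrFun hQ.2 ⟨_, cyl_mem_cylAlgebra ω t⟩).symm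
  have := eq_of_mergesAlong (isRefining_word hS) (isFinAdd_extendZero hP)
    (isFinAdd_extendZero hQ.1) hcell ((merges_iff_mergesAlong hS hP hQ.1).1 h) E.2
  rwa [extendZero_of_mem P E.2, extendZero_of_mem Q E.2] at this

end Merging

end

theorem theorem8 (S : MeasurableSpace Merging.Path) (hS : Merging.ContainsCylinders S)
    (P : Merging.events S → ℝ) (hP : P ∈ Merging.finAddProb (Merging.events S)) :
    List.TFAE [
      P ∈ Set.extremePoints ℝ
        (Merging.extensions (Merging.cylAlgebra_subset_events hS)
          (Merging.restrict (Merging.cylAlgebra_subset_events hS) P)),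
      Merging.BlackwellDubins hS P,
      ∀ Q ∈ Merging.finAddProb (Merging.events S), ∀ R ∈ Merging.finAddProb (Merging.events S),
        ∀ α ∈ Set.Ioo (0 : ℝ) 1, P = α • Q + (1 - α) • R →
          Merging.Merges hS P Q ∧ Merging.Merges hS P R] := by
  tfae_have 1 → 2 := fun h Q hQ hQP =>
    (Merging.merges_iff_mergesAlong hS hP hQ).2 <|
      Merging.mergesAlong_of_cellsDense (Merging.isRefining_word hS)
        (Merging.isFinAdd_extendZero hP) (Merging.isFinAdd_extendZero hQ)
        (Merging.cellsDense_of_mem_extremePoints hS hP h) (hQP.unifAbsCont hP)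
  tfae_have 2 → 3 := fun h Q hQ R hR α hα hPQR =>
    ⟨h.merges_of_mixture hQ hR hα.1 (sub_pos.2 hα.2) hPQR,
      h.merges_of_mixture hR hQ (sub_pos.2 hα.2) hα.1 (by rw [hPQR, add_comm])⟩
  tfae_have 3 → 1 := by
    refine fun h => ⟨⟨hP, rfl⟩, ?_⟩
    rintro Q hQ R hR ⟨a, b, ha, hb, hab, hPQR⟩
    have hb' : b = 1 - a := by linarith
    subst hb'
    exact (Merging.eq_of_mem_extensions_of_merges hS hP hQ
      (h Q hQ.1 R hR.1 a ⟨ha, sub_pos.1 hb⟩ hPQR.symm).1).symm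
  tfae_finish
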